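/- **Setting.** Oriented link diagrams and crossing signs are the usual ones. The Jones polynomial $V(L)\in\mathbb{Z}[t^{1/2},t^{-1/2}]$ of an oriented link is normalized by $V(\text{unknot})=1$ and satisfies $t^{-1}V(L_+)-t\,V(L_-)+(t^{-1/2}-t^{1/2})V(L_0)=0$; equivalently $V=\big((-A)^{-3w(D)}\langle D\rangle\big)_{t^{1/2}=A^{-2}}$ for any diagram $D$ with writhe $w(D)$ and Kauffman bracket $\langle D\rangle$. An *even continued fraction* is a finite sequence $[b_1,\dots,b_m]$ of nonzero even integers. Its *type sequence* is $(\operatorname{sgn}(b_1),-\operatorname{sgn}(b_2),\dots,(-1)^{m+1}\operatorname{sgn}(b_m))$; it is *of type* $(\dots,-)$ or $(\dots,+)$ according to the last entry of this sequence. The oriented 2-bridge link $C[b_1,\dots,b_m]$ is given by the following diagram. Take four horizontal strands, numbered $1$ to $4$ from top to bottom and directed alternately to the right, left, right, left; join the left ends of strands $1,2$ and of strands $3,4$. From left to right insert two-strand braids, the $i$-th one with $|b_i|$ crossings, between strands $2,3$ if $i$ is odd and between strands $1,2$ if $i$ is even, such that all crossings of the $i$-th braid have the sign $(-1)^{i+1}\operatorname{sgn}(b_i)$.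 Finally join the right ends of strands $1,2$ and of strands $3,4$ if $m$ is odd, and those of strands $2,3$ and of strands $1,4$ if $m$ is even. Let $V_{[b_1,\dots,b_m]}$ be the Jones polynomial of $C[b_1,\dots,b_m]$. For $m=0$ this is the Jones polynomial of the unknot; by convention $V_{[b_1,\dots,b_{-1}]}$ denotes the Jones polynomial of two disjoint unknots. For an integer $b>0$ put $[b]_q=1+q+\dots+q^{b-1}$, where $q=-t^{-1}$, and $[b]_{\bar q}=1+\bar q+\dots+\bar q^{\,b-1}$, where $\bar q=-t$. **Theorem 5.3.** Let $[b_1,\dots,b_m]$ be an even continued fraction with $m\ge 1$. Then $$V_{[b_1,\dots,b_m]}=\begin{cases} t^{-|b_m|}\,V_{[b_1,\dots,b_{m-2}]}-t^{-1/2}\,[\,|b_m|\,]_q\,V_{[b_1,\dots,b_{m-1}]} & \text{in type } (\dots,-),\\[4pt] t^{|b_m|}\,V_{[b_1,\dots,b_{m-2}]}-t^{1/2}\,[\,|b_m|\,]_{\bar q}\,V_{[b_1,\dots,b_{m-1}]} & \text{in type } (\dots,+),\end{cases}$$ where $V_{[b_1,\dots,b_0]}=1$ and $V_{[b_1,\dots,b_{-1}]}=-t^{-1/2}-t^{1/2}$.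 In particular, $$V_{[b_1]}=\begin{cases} t^{b_1}(-t^{-1/2}-t^{1/2})-t^{-1/2}\,[-b_1]_q & \text{if } b_1<0,\\[4pt] t^{b_1}(-t^{-1/2}-t^{1/2})-t^{1/2}\,[b_1]_{\bar q} & \text{if } b_1>0.\end{cases}$$ -/

import Mathlib

/-!
# Oriented link diagrams, the Jones polynomial, and the links `C[b₁, …, bₘ]`

Link diagrams are drawn in the plane in general position with respect to the horizontal
coordinate and are scanned from left to right.  A vertical line that avoids crossings and turning
points meets the diagram in finitely many strands, numbered `0, 1, 2, …` from top to bottom.  Each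
strand has a direction there: `true` means "running to the right", `false` "running to the left".
-/

namespace TwoBridge

/-- `OrientedTangle ε` is the type of oriented planar diagrams without end points on the left, and
whose end points on the right carry, from top to bottom, the directions listed in `ε`.
A new elementary piece is always attached on the right. -/
inductive OrientedTangle : List Bool → Type
  /-- The empty diagram. -/
  | empty : OrientedTangle []
  /-- A left turning point (shape `⊂`) between the strands `l` and the strands `r`; it creates two
  neighbouring strands of opposite directions. -/
  | cup (l r : List Bool) (a : Bool) :
      OrientedTangle (l ++ r) → OrientedTangle (l ++ a :: (!a) :: r)
  /-- A right turning point (shape `⊃`); it joins two neighbouring strands of opposite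
  directions. -/
  | cap (l r : List Bool) (a : Bool) :
      OrientedTangle (l ++ a :: (!a) :: r) → OrientedTangle (l ++ r)
  /-- A crossing of two neighbouring strands.  If `o = true`, then the over-strand is the one
  which runs, from left to right, from the upper left to the lower right (shape `\`); if
  `o = false`, it is the one from the lower left to the upper right (shape `/`). -/
  | cross (l r : List Bool) (a b : Bool) (o : Bool) :
      OrientedTangle (l ++ a :: b :: r) → OrientedTangle (l ++ b :: a :: r)

/-- An oriented link diagram is a diagram without end points. -/
abbrev OrientedLinkDiagram : Type := OrientedTangle []

/-! ### The writhe -/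

/-- The sum of the signs of the crossings.  With both strands running to the right, a crossing
whose over-strand has shape `\` is positive and one whose over-strand has shape `/` is negative;
reversing one of the two strands changes the sign. -/
def writhe : {ε : List Bool} → OrientedTangle ε → ℤ
  | _, .empty => 0
  | _, .cup _ _ _ D => writhe D
  | _, .cap _ _ _ D => writhe D
  | _, .cross _ _ a b o D => writhe D + (if o = (a == b) then 1 else -1)

/-! ### Kauffman states and the Jones polynomial -/

/-- A crossingless diagram as seen from its right end: `ends` lists, from top to bottom, labels of
the end points, where two end points have the same label iff they are the two ends of one arc;
`fresh` is a label not used so far; `loops` is the number of closed curves. -/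
structure Arcs where
  ends : List ℕ
  fresh : ℕ
  loops : ℕ

/-- Attach a left turning point `⊂` that creates the strands `p` and `p + 1`. -/
def Arcs.cup (p : ℕ) (S : Arcs) : Arcs where
  ends := S.ends.take p ++ S.fresh :: S.fresh :: S.ends.drop p
  fresh := S.fresh + 1
  loops := S.loops

/-- Attach a right turning point `⊃` that joins the strands `p` and `p + 1`: if these are the two
ends of one arc, a closed curve arises, otherwise their two arcs become one arc. -/
def Arcs.cap (p : ℕ) (S : Arcs) : Arcs :=
  let x := S.ends.getD p 0
  let y := S.ends.getD (p + 1) 0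
  let rest := S.ends.take p ++ S.ends.drop (p + 2)
  if x = y then
    { ends := rest, fresh := S.fresh, loops := S.loops + 1 }
  else
    { ends := rest.map fun z => if z = y then x else z, fresh := S.fresh, loops := S.loops }

/-- The list of all Kauffman states of a diagram (two for each crossing): for every state the
number of `A`-smoothings minus the number of `B`-smoothings, and the smoothed diagram.

The `A`-smoothing of a crossing joins the two regions that are swept out when the over-strand is
turned counterclockwise until it meets the under-strand.  For the shape `\` these are the regions
to the left and to the right, so that the `A`-smoothing consists of two horizontal strands and the
`B`-smoothing is `⊃ ⊂`; for the shape `/` it is the other way round. -/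
def states : {ε : List Bool} → OrientedTangle ε → List (ℤ × Arcs)
  | _, .empty => [(0, { ends := [], fresh := 0, loops := 0 })]
  | _, .cup l _ _ D => (states D).map fun s => (s.1, s.2.cup l.length)
  | _, .cap l _ _ D => (states D).map fun s => (s.1, s.2.cap l.length)
  | _, .cross l _ _ _ o D => (states D).flatMap fun s =>
      let e : ℤ := if o then 1 else -1
      [(s.1 + e, s.2), (s.1 - e, (s.2.cap l.length).cup l.length)]

/-- The Kauffman bracket `⟨D⟩ = ∑ A ^ (a - b) * (-A ^ 2 - A ^ (-2)) ^ (#loops - 1)` in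
`ℤ[A, A⁻¹]`, the sum being over all states; here `LaurentPolynomial.T n` is `A ^ n`. -/
noncomputable def bracket (D : OrientedLinkDiagram) : LaurentPolynomial ℤ :=
  ((states D).map fun s => LaurentPolynomial.T s.1 *
    (-LaurentPolynomial.T 2 - LaurentPolynomial.T (-2)) ^ (s.2.loops - 1)).sum

/-- The Jones polynomial `V = (-A) ^ (-3 w) ⟨D⟩`, where `w` is the writhe.  It is a Laurent
polynomial in `t ^ (1 / 2) = A ^ (-2)`, and is written here as an element of `ℤ[A, A⁻¹]`. -/
noncomputable def jones (D : OrientedLinkDiagram) : LaurentPolynomial ℤ :=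
  (-1) ^ (writhe D).natAbs * LaurentPolynomial.T (-3 * writhe D) * bracket D

/-- The power `t ^ (n / 2)`, where `t ^ (1 / 2) = A ^ (-2)`. -/
noncomputable def tHalf (n : ℤ) : LaurentPolynomial ℤ := LaurentPolynomial.T (-2 * n)

/-! ### The link diagrams `C[b₁, …, bₘ]` -/

/-- The directions of the four horizontal strands in `C[b₁, …, bₘ]`: neighbours are
antiparallel. -/
abbrev dirs : List Bool := [true, false, true, false]

/-- The left end of the diagram: strands `0, 1` are joined, and strands `2, 3` are joined. -/
def leftEnd : OrientedTangle dirs := .cup [true, false] [] true (.cup [] [] true .empty)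

/-- Two crossings of the same kind between the two middle strands `1` and `2`. -/
def middleTwist (o : Bool) (D : OrientedTangle dirs) : OrientedTangle dirs :=
  .cross [true] [false] true false o (.cross [true] [false] false true o D)

/-- Two crossings of the same kind between the two top strands `0` and `1`. -/
def topTwist (o : Bool) (D : OrientedTangle dirs) : OrientedTangle dirs :=
  .cross [] [true, false] false true o (.cross [] [true, false] true false o D)

/-- Attach the `|b|` crossings (`b` even) of the braid of an entry `b`.  The braids of
`b₁, b₃, b₅, …` (`odd = true`) lie on the middle strands, with over-strands of shape `/` if
`b > 0` and `\` if `b < 0`; those of `b₂, b₄, …` (`odd = false`) lie on the top strands, with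
over-strands of shape `\` if `b > 0` and `/` if `b < 0`.  So the diagram alternates from one braid
to the next iff the two entries have the same sign, and the crossings of the first braid have the
sign of `b₁`. -/
def attachBraid (odd : Bool) (b : ℤ) (D : OrientedTangle dirs) : OrientedTangle dirs :=
  if odd then (middleTwist (decide (b < 0)))^[b.natAbs / 2] D
  else (topTwist (decide (0 < b)))^[b.natAbs / 2] D

/-- Attach the braids of the remaining entries, the first of which has odd index iff
`odd = true`, and close up on the right.  After a braid on the middle strands, the strands `0, 1`
and `2, 3` are joined; after a braid on the top strands (or with no braid at all), the strands
`1, 2` and the strands `0, 3` are joined. -/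
def attachAll : (odd : Bool) → List ℤ → OrientedTangle dirs → OrientedLinkDiagram
  | odd, b :: bs, D => attachAll (!odd) bs (attachBraid odd b D)
  | false, [], D => .cap [] [] true (.cap [] [true, false] true D)
  | true, [], D => .cap [] [] true (.cap [true] [false] false D)

/-- The oriented link diagram `C[b₁, …, bₘ]` for even integers `b₁, …, bₘ`. -/
def twoBridge (b : List ℤ) : OrientedLinkDiagram := attachAll true b leftEnd

/-- Two disjoint circles without crossings. -/
def twoCircles : OrientedLinkDiagram :=
  .cap [] [] true (.cup [] [] true (.cap [] [] true (.cup [] [] true .empty)))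

/-- `jonesTrunc b k` is `V_{[b₁, …, bₖ]}` for `k ≥ 0`; for `k = -1` it is, by convention, the Jones
polynomial of two disjoint unknots. -/
noncomputable def jonesTrunc (b : List ℤ) : ℤ → LaurentPolynomial ℤ
  | .ofNat k => jones (twoBridge (b.take k))
  | .negSucc _ => jones twoCircles

/-! ### Even continued fractions -/

/-- `[b₁, …, bₘ]` is an even continued fraction: all entries are nonzero even integers. -/
def IsEvenCF (b : List ℤ) : Prop := ∀ x ∈ b, Even x ∧ x ≠ 0

/-- The type sequence `(sgn b₁, -sgn b₂, …, (-1) ^ (m + 1) sgn bₘ)`. -/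
def typeSeq (b : List ℤ) : List ℤ := b.mapIdx fun i x => (-1) ^ i * x.sign

/-- The `q`-analogue `[n]_q = 1 + q + ⋯ + q ^ (n - 1)`. -/
def qAnalogue {R : Type*} [CommRing R] (n : ℕ) (q : R) : R := ∑ i ∈ Finset.range n, q ^ i

end TwoBridge

/-! Resolving all crossings expands a four-ended diagram in the two crossingless pairings `{01, 23}`
and `{03, 12}`, with coefficients in `ℤ[A, A⁻¹]`; diagrams enter the proof only through these two
coefficients. A braid on the strands selected by `mid` acts on them triangularly: its turn-back
smoothing always produces the pairing `mid`. With `s` the crossing sign and `u`, `v` the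
writhe-normalized coefficients at `!mid` and `mid`, a braid of `|b|` crossings sends `u` to
`t^(s|b|) u` and `v` to `v - t^(s/2) [|b|] u`, where `[|b|]` is taken at `-t^s`
(`normCoeff_not_attachBraid`, `normCoeff_attachBraid`).

Write `δ` for the value of a loop. The two closures have Jones polynomials `u + δ v` and `v + δ u`
(`jones_attachAll_nil`), and the geometric sum gives `t^(s/2) [|b|] δ = t^(s|b|) - 1`. Hence the
closure that joins the braid's own strands forgets the braid, while the other closure satisfies a
two-term recursion. Applied to the last braid of `C[b₁, …, bₘ]`, one term is `V_{[b₁, …, bₘ₋₁]}`;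
the other is the opposite closure of the same open diagram, which forgets `bₘ₋₁` and so equals
`V_{[b₁, …, bₘ₋₂]}`. -/

open LaurentPolynomial

namespace TwoBridge

/-! ### States of a diagram with four end points -/

/-- The four end points are joined by two arcs, without crossings. -/
def Arcs.IsPairing (S : Arcs) : Prop :=
  ∃ x y, x ≠ y ∧ x < S.fresh ∧ y < S.fresh ∧ (S.ends = [x, x, y, y] ∨ S.ends = [x, y, y, x])

/-- The value `-A ^ 2 - A ^ (-2)` of a closed curve. -/
noncomputable abbrev loopValue : ℤ[T;T⁻¹] := -T 2 - T (-2)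

/-- The contribution of the loops if the arcs join the strands `0, 1` and `2, 3`
(`nested = false`) or `0, 3` and `1, 2` (`nested = true`), and `0` otherwise. -/
noncomputable def Arcs.weight (nested : Bool) (S : Arcs) : ℤ[T;T⁻¹] :=
  if (S.ends.getD 0 0 = S.ends.getD 1 0) ↔ nested = false then loopValue ^ S.loops else 0

/-- The coefficient of a diagram with four end points at one of the two crossingless pairings in
its Kauffman bracket expansion. -/
noncomputable def coeff {ε : List Bool} (nested : Bool) (D : OrientedTangle ε) : ℤ[T;T⁻¹] :=
  ((states D).map fun s => T s.1 * s.2.weight nested).sum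

theorem Arcs.IsPairing.turnMiddle {S : Arcs} (h : S.IsPairing) :
    ((S.cap 1).cup 1).IsPairing ∧ ((S.cap 1).cup 1).weight false = 0 ∧
      ((S.cap 1).cup 1).weight true = S.weight false + loopValue * S.weight true := by
  obtain ⟨ends, fresh, loops⟩ := S
  obtain ⟨x, y, hxy, hx, hy, rfl | rfl⟩ := h <;> simp only at hx hy
  · have : x ≠ fresh := hx.ne
    -- The cap fuses the two arcs into one, which keeps the label `x` and becomes the outer arc; the
    -- new inner arc is `fresh`.
    refine ⟨⟨x, fresh, ?_⟩, ?_, ?_⟩ <;> simp [Arcs.cap, Arcs.cup, Arcs.weight, hxy, this] ; omega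
  · have : x ≠ fresh := hx.ne
    refine ⟨⟨x, fresh, ?_⟩, ?_, ?_⟩ <;> simp [Arcs.cap, Arcs.cup, Arcs.weight, hxy, this]
    · omega
    · ring

theorem Arcs.IsPairing.turnTop {S : Arcs} (h : S.IsPairing) :
    ((S.cap 0).cup 0).IsPairing ∧ ((S.cap 0).cup 0).weight true = 0 ∧
      ((S.cap 0).cup 0).weight false = S.weight true + loopValue * S.weight false := by
  obtain ⟨ends, fresh, loops⟩ := S
  obtain ⟨x, y, hxy, hx, hy, rfl | rfl⟩ := h <;> simp only at hx hy
  · have : fresh ≠ y := hy.ne'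
    refine ⟨⟨fresh, y, ?_⟩, ?_, ?_⟩ <;> simp [Arcs.cap, Arcs.cup, Arcs.weight, this]
    · omega
    · ring
  · have : fresh ≠ x := hx.ne'
    refine ⟨⟨fresh, x, ?_⟩, ?_, ?_⟩ <;> simp [Arcs.cap, Arcs.cup, Arcs.weight, hxy, this] ; omega

/-- Closing always creates at least one loop, so the truncated subtraction loses nothing. -/
theorem Arcs.IsPairing.closeOuter {S : Arcs} (h : S.IsPairing) :
    loopValue ^ (((S.cap 0).cap 0).loops - 1) = S.weight true + loopValue * S.weight false := by
  obtain ⟨ends, fresh, loops⟩ := S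
  obtain ⟨x, y, hxy, hx, hy, rfl | rfl⟩ := h
  · simp [Arcs.cap, Arcs.weight]; ring
  · simp [Arcs.cap, Arcs.weight, hxy]

theorem Arcs.IsPairing.closeInner {S : Arcs} (h : S.IsPairing) :
    loopValue ^ (((S.cap 1).cap 0).loops - 1) = S.weight false + loopValue * S.weight true := by
  obtain ⟨ends, fresh, loops⟩ := S
  obtain ⟨x, y, hxy, hx, hy, rfl | rfl⟩ := h
  · simp [Arcs.cap, Arcs.weight, hxy]
  · simp [Arcs.cap, Arcs.weight, hxy]; ring

/-- All states of the diagram are pairings of four end points. -/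
def StatesPaired {ε : List Bool} (D : OrientedTangle ε) : Prop := ∀ s ∈ states D, s.2.IsPairing

/-- The exponent of `A` of the smoothing of a crossing of shape `o` into horizontal strands. -/
def shapeSign (o : Bool) : ℤ := if o then 1 else -1

/-- The Kauffman skein relation at the last crossing, for an arbitrary weight on smoothed diagrams.
-/
theorem sum_states_cross (l r : List Bool) (a b o : Bool) (D : OrientedTangle (l ++ a :: b :: r))
    (w : Arcs → ℤ[T;T⁻¹]) :
    ((states (.cross l r a b o D)).map fun s => T s.1 * w s.2).sum =
      ((states D).map fun s => T s.1 * (T (shapeSign o) * w s.2 +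
        T (-shapeSign o) * w ((s.2.cap l.length).cup l.length))).sum := by
  simp only [states]
  induction states D with
  | nil => simp
  | cons s L ih =>
    simp only [List.flatMap_cons, List.map_append, List.sum_append, ih, List.map_cons,
      List.sum_cons, List.map_nil, List.sum_nil, add_zero]
    rw [sub_eq_add_neg, T_add, T_add, shapeSign]
    ring

/-- Any weight that is linear in the two pairing weights can be summed through the two coefficients;
this serves both crossings and closures. -/
theorem sum_states_linear {ε : List Bool} {D : OrientedTangle ε} (hD : StatesPaired D)
    {w : Arcs → ℤ[T;T⁻¹]} (c d : ℤ[T;T⁻¹]) (n : Bool)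
    (hw : ∀ S : Arcs, S.IsPairing → w S = c * S.weight n + d * S.weight (!n)) :
    ((states D).map fun s => T s.1 * w s.2).sum = c * coeff n D + d * coeff (!n) D := by
  unfold StatesPaired at hD
  unfold coeff
  generalize states D = L at hD ⊢
  induction L with
  | nil => simp
  | cons s L ih =>
    simp only [List.map_cons, List.sum_cons, hw s.2 (hD s (by simp)),
      ih fun s hs => hD s (by simp [hs])]
    ring

theorem statesPaired_cross {l r : List Bool} {a b o : Bool}
    {D : OrientedTangle (l ++ a :: b :: r)} (hD : StatesPaired D)
    (hl : ∀ S : Arcs, S.IsPairing → ((S.cap l.length).cup l.length).IsPairing) :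
    StatesPaired (.cross l r a b o D) := by
  intro s hs
  simp only [states, List.mem_flatMap, List.mem_cons, List.not_mem_nil, or_false] at hs
  obtain ⟨s', hs', rfl | rfl⟩ := hs
  exacts [hD s' hs', hl _ (hD s' hs')]

/-- The position of the upper strand of a braid on the middle strands (`mid = true`) or on the
top strands. -/
def braidPos (mid : Bool) : ℕ := if mid then 1 else 0

theorem Arcs.IsPairing.turn {S : Arcs} (h : S.IsPairing) (mid : Bool) :
    ((S.cap (braidPos mid)).cup (braidPos mid)).IsPairing ∧
      ((S.cap (braidPos mid)).cup (braidPos mid)).weight (!mid) = 0 ∧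
      ((S.cap (braidPos mid)).cup (braidPos mid)).weight mid =
        S.weight (!mid) + loopValue * S.weight mid := by
  cases mid
  exacts [h.turnTop, h.turnMiddle]

/-- The bracket of a kink, as in the first Reidemeister move. -/
theorem T_add_T_neg_mul_loopValue (o : Bool) :
    T (shapeSign o) + T (-shapeSign o) * loopValue = -T (-3 * shapeSign o) := by
  rw [loopValue, mul_sub, mul_neg, ← T_add, ← T_add]
  cases o <;> (norm_num [shapeSign]; try abel)

section Crossing

variable {l r : List Bool} {a b o mid : Bool} {D : OrientedTangle (l ++ a :: b :: r)}

/-- The turn-back smoothing never yields the pairing `!mid`, so only the horizontal smoothing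
contributes. -/
theorem coeff_not_cross (hl : l.length = braidPos mid) (hD : StatesPaired D) :
    coeff (!mid) (.cross l r a b o D) = T (shapeSign o) * coeff (!mid) D := by
  rw [coeff, sum_states_cross, sum_states_linear hD (w := fun S => T (shapeSign o) *
    S.weight (!mid) + T (-shapeSign o) * ((S.cap l.length).cup l.length).weight (!mid))
    (T (shapeSign o)) 0 (!mid)]
  · simp
  · intro S hS
    simp [hl, (hS.turn mid).2.1]

theorem coeff_cross (hl : l.length = braidPos mid) (hD : StatesPaired D) :
    coeff mid (.cross l r a b o D) =
      -T (-3 * shapeSign o) * coeff mid D + T (-shapeSign o) * coeff (!mid) D := by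
  rw [coeff, sum_states_cross, sum_states_linear hD (w := fun S => T (shapeSign o) *
    S.weight mid + T (-shapeSign o) * ((S.cap l.length).cup l.length).weight mid)
    (-T (-3 * shapeSign o)) (T (-shapeSign o)) mid]
  intro S hS
  simp only [hl, (hS.turn mid).2.2, ← T_add_T_neg_mul_loopValue]
  ring

end Crossing

/-! ### Normalization by the writhe -/

/-- The factor `(-A) ^ (-3 w)`. -/
noncomputable def framing (w : ℤ) : ℤ[T;T⁻¹] := (-1) ^ w.natAbs * T (-3 * w)

/-- Crossings are added in pairs, so the sign `(-1) ^ w` does not change. -/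
theorem framing_add_two_mul (w k : ℤ) : framing (w + 2 * k) = T (-6 * k) * framing w := by
  have h : ((-1) ^ (w + 2 * k).natAbs : ℤ[T;T⁻¹]) = (-1) ^ w.natAbs := by
    rcases Int.even_or_odd w with hw | hw
    · rw [(Int.natAbs_even.2 hw).neg_one_pow,
        (Int.natAbs_even.2 (hw.add (even_two_mul k))).neg_one_pow]
    · rw [(Int.natAbs_odd.2 hw).neg_one_pow,
        (Int.natAbs_odd.2 (hw.add_even (even_two_mul k))).neg_one_pow]
  rw [framing, framing, h, show -3 * (w + 2 * k) = -6 * k + -3 * w by ring, T_add]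
  ring

/-- The coefficient of a diagram at a crossingless pairing, normalized by the writhe. -/
noncomputable def normCoeff {ε : List Bool} (nested : Bool) (D : OrientedTangle ε) : ℤ[T;T⁻¹] :=
  framing (writhe D) * coeff nested D

/-- Two crossings of the same kind on the middle strands (`mid = true`) or on the top strands. -/
def twist (mid o : Bool) (D : OrientedTangle dirs) : OrientedTangle dirs :=
  if mid then middleTwist o D else topTwist o D

theorem StatesPaired.twist {D : OrientedTangle dirs} (hD : StatesPaired D) (mid o : Bool) :
    StatesPaired (twist mid o D) := by
  cases mid
  · exact statesPaired_cross (statesPaired_cross hD fun S h => h.turnTop.1) fun S h => h.turnTop.1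
  · exact statesPaired_cross (statesPaired_cross hD fun S h => h.turnMiddle.1)
      fun S h => h.turnMiddle.1

/-- The twisted strands are antiparallel, so each crossing has sign `-shapeSign o`. -/
theorem writhe_twist (mid o : Bool) (D : OrientedTangle dirs) :
    writhe (twist mid o D) = writhe D + 2 * -shapeSign o := by
  cases mid <;> cases o <;> simp [twist, middleTwist, topTwist, writhe, shapeSign] <;> ring

theorem coeff_not_twist {D : OrientedTangle dirs} (hD : StatesPaired D) (mid o : Bool) :
    coeff (!mid) (twist mid o D) = T (2 * shapeSign o) * coeff (!mid) D := by
  cases mid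
  · have h1 : StatesPaired (.cross [] [true, false] true false o D) :=
      statesPaired_cross hD fun S h => h.turnTop.1
    have e1 := coeff_not_cross (mid := false) (o := o) rfl h1
    have e2 := coeff_not_cross (mid := false) (o := o) (l := []) rfl hD
    refine e1.trans ?_
    rw [e2, two_mul, T_add, mul_assoc]
  · have h1 : StatesPaired (.cross [true] [false] false true o D) :=
      statesPaired_cross hD fun S h => h.turnMiddle.1
    have e1 := coeff_not_cross (mid := true) (o := o) rfl h1
    have e2 := coeff_not_cross (mid := true) (o := o) (l := [true]) rfl hD
    refine e1.trans ?_
    rw [e2, two_mul, T_add, mul_assoc]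

theorem coeff_twist {D : OrientedTangle dirs} (hD : StatesPaired D) (mid o : Bool) :
    coeff mid (twist mid o D) =
      T (-6 * shapeSign o) * coeff mid D + (1 - T (-4 * shapeSign o)) * coeff (!mid) D := by
  have key : ∀ x y : ℤ[T;T⁻¹], -T (-3 * shapeSign o) *
      (-T (-3 * shapeSign o) * x + T (-shapeSign o) * y) + T (-shapeSign o) * (T (shapeSign o) * y)
      = T (-6 * shapeSign o) * x + (1 - T (-4 * shapeSign o)) * y := by
    intro x y
    rw [show -6 * shapeSign o = -3 * shapeSign o + -3 * shapeSign o by ring,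
      show -4 * shapeSign o = -3 * shapeSign o + -shapeSign o by ring, T_add, T_add]
    have h : (T (-shapeSign o) * T (shapeSign o) : ℤ[T;T⁻¹]) = 1 := by
      rw [← T_add, neg_add_cancel, T_zero]
    linear_combination y * h
  cases mid
  · have h1 : StatesPaired (.cross [] [true, false] true false o D) :=
      statesPaired_cross hD fun S h => h.turnTop.1
    have e1 := coeff_cross (mid := false) (o := o) rfl h1
    have e2 := coeff_cross (mid := false) (o := o) (l := []) rfl hD
    have e3 := coeff_not_cross (mid := false) (o := o) (l := []) rfl hD
    refine e1.trans ?_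
    rw [e2, e3, key]
  · have h1 : StatesPaired (.cross [true] [false] false true o D) :=
      statesPaired_cross hD fun S h => h.turnMiddle.1
    have e1 := coeff_cross (mid := true) (o := o) rfl h1
    have e2 := coeff_cross (mid := true) (o := o) (l := [true]) rfl hD
    have e3 := coeff_not_cross (mid := true) (o := o) (l := [true]) rfl hD
    refine e1.trans ?_
    rw [e2, e3, key]

theorem normCoeff_not_twist {D : OrientedTangle dirs} (hD : StatesPaired D) (mid o : Bool) :
    normCoeff (!mid) (twist mid o D) = tHalf (-4 * shapeSign o) * normCoeff (!mid) D := by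
  rw [normCoeff, normCoeff, writhe_twist, framing_add_two_mul, coeff_not_twist hD, tHalf,
    show -2 * (-4 * shapeSign o) = -6 * -shapeSign o + 2 * shapeSign o by ring, T_add]
  ring

/-- The writhe factor cancels the two kink factors, so the coefficient at `mid` is only shifted. -/
theorem normCoeff_twist {D : OrientedTangle dirs} (hD : StatesPaired D) (mid o : Bool) :
    normCoeff mid (twist mid o D) = normCoeff mid D +
      (tHalf (-3 * shapeSign o) - tHalf (-shapeSign o)) * normCoeff (!mid) D := by
  rw [normCoeff, normCoeff, normCoeff, writhe_twist, framing_add_two_mul, coeff_twist hD, tHalf,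
    tHalf, show -2 * (-3 * shapeSign o) = -6 * -shapeSign o by ring,
    show -2 * -shapeSign o = -6 * -shapeSign o + -4 * shapeSign o by ring, T_add]
  have h : (T (-6 * -shapeSign o) * T (-6 * shapeSign o) : ℤ[T;T⁻¹]) = 1 := by
    rw [← T_add, ← mul_add, neg_add_cancel, mul_zero, T_zero]
  linear_combination framing (writhe D) * coeff mid D * h

/-! ### Braids -/

theorem tHalf_add (m n : ℤ) : tHalf (m + n) = tHalf m * tHalf n := by
  rw [tHalf, mul_add, T_add, tHalf, tHalf]

theorem neg_tHalf_pow (s : ℤ) (n : ℕ) : (-tHalf s) ^ (2 * n) = tHalf (2 * n * s) := by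
  rw [(even_two_mul n).neg_pow, tHalf, tHalf, T_pow]
  push_cast
  congr 1
  ring

theorem qAnalogue_add_two (s : ℤ) (n : ℕ) :
    qAnalogue (2 * (n + 1)) (-tHalf s) =
      qAnalogue (2 * n) (-tHalf s) + tHalf (2 * n * s) * (1 - tHalf s) := by
  rw [qAnalogue, qAnalogue, mul_add, mul_one, Finset.sum_range_succ, Finset.sum_range_succ,
    pow_succ, neg_tHalf_pow]
  ring

/-- `qAnalogue n q` satisfies `[n]_q (1 - q) = 1 - q ^ n`; here `q = -t ^ s`. -/
theorem tHalf_mul_qAnalogue_mul_loopValue {s : ℤ} (hs : s = 1 ∨ s = -1) (n : ℕ) :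
    tHalf s * qAnalogue (2 * n) (-tHalf (2 * s)) * loopValue = tHalf (4 * n * s) - 1 := by
  have h : tHalf s * loopValue = -(1 - -tHalf (2 * s)) := by
    rw [tHalf, tHalf, loopValue, mul_sub, mul_neg, ← T_add, ← T_add]
    rcases hs with rfl | rfl <;> norm_num <;> ring
  have hg := mul_neg_geom_sum (-tHalf (2 * s)) (2 * n)
  rw [neg_tHalf_pow, show (2 * n * (2 * s) : ℤ) = 4 * n * s by ring] at hg
  rw [qAnalogue]
  linear_combination (∑ i ∈ Finset.range (2 * n), (-tHalf (2 * s)) ^ i) * h - hg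

theorem StatesPaired.iterate_twist {D : OrientedTangle dirs} (hD : StatesPaired D) (mid o : Bool)
    (n : ℕ) : StatesPaired ((TwoBridge.twist mid o)^[n] D) := by
  induction n with
  | zero => exact hD
  | succ n ih => rw [Function.iterate_succ_apply']; exact ih.twist mid o

theorem normCoeff_not_iterate_twist {D : OrientedTangle dirs} (hD : StatesPaired D) (mid o : Bool)
    (n : ℕ) : normCoeff (!mid) ((twist mid o)^[n] D) =
      tHalf (4 * n * -shapeSign o) * normCoeff (!mid) D := by
  induction n with
  | zero => simp [tHalf]
  | succ n ih =>
    rw [Function.iterate_succ_apply', normCoeff_not_twist (hD.iterate_twist mid o n), ih,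
      ← mul_assoc, ← tHalf_add]
    push_cast
    ring_nf

/-- With `q = -t^s`, the `n`-th pair contributes `-t^(s/2) (q^(2n) + q^(2n+1))`, counting from `n =
0`; these terms add up to the `q`-analogue. -/
theorem normCoeff_iterate_twist {D : OrientedTangle dirs} (hD : StatesPaired D) (mid o : Bool)
    (n : ℕ) : normCoeff mid ((twist mid o)^[n] D) = normCoeff mid D -
      tHalf (-shapeSign o) * qAnalogue (2 * n) (-tHalf (2 * -shapeSign o)) *
        normCoeff (!mid) D := by
  induction n with
  | zero => simp [qAnalogue]
  | succ n ih =>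
    rw [Function.iterate_succ_apply', normCoeff_twist (hD.iterate_twist mid o n), ih,
      qAnalogue_add_two, normCoeff_not_iterate_twist hD,
      show -3 * shapeSign o = -shapeSign o + 2 * -shapeSign o by ring, tHalf_add,
      show (2 * n * (2 * -shapeSign o) : ℤ) = 4 * n * -shapeSign o by ring]
    ring

/-- The sign of the crossings in the braid of an entry `b`. -/
def braidSign (mid : Bool) (b : ℤ) : ℤ := -shapeSign (if mid then decide (b < 0) else decide (0 < b))

theorem attachBraid_eq_iterate (mid : Bool) (b : ℤ) (D : OrientedTangle dirs) :
    attachBraid mid b D =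
      (twist mid (if mid then decide (b < 0) else decide (0 < b)))^[b.natAbs / 2] D := by
  cases mid <;> rfl

theorem braidSign_eq (mid : Bool) (b : ℤ) : braidSign mid b = 1 ∨ braidSign mid b = -1 := by
  unfold braidSign shapeSign
  split_ifs <;> simp

section Braid

variable {D : OrientedTangle dirs} {b : ℤ} (mid : Bool)

theorem StatesPaired.attachBraid (hD : StatesPaired D) (b : ℤ) :
    StatesPaired (attachBraid mid b D) := by
  rw [attachBraid_eq_iterate]
  exact hD.iterate_twist _ _ _

theorem normCoeff_not_attachBraid (hD : StatesPaired D) (hb : Even b) :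
    normCoeff (!mid) (attachBraid mid b D) =
      tHalf (2 * |b| * braidSign mid b) * normCoeff (!mid) D := by
  obtain ⟨k, hk⟩ := Int.natAbs_even.2 hb
  rw [attachBraid_eq_iterate, normCoeff_not_iterate_twist hD, braidSign, Int.abs_eq_natAbs, hk,
    ← two_mul, Nat.mul_div_cancel_left k two_pos]
  push_cast
  ring_nf

theorem normCoeff_attachBraid (hD : StatesPaired D) (hb : Even b) :
    normCoeff mid (attachBraid mid b D) = normCoeff mid D -
      tHalf (braidSign mid b) * qAnalogue b.natAbs (-tHalf (2 * braidSign mid b)) *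
        normCoeff (!mid) D := by
  obtain ⟨k, hk⟩ := Int.natAbs_even.2 hb
  rw [attachBraid_eq_iterate, normCoeff_iterate_twist hD, braidSign, hk,
    ← two_mul, Nat.mul_div_cancel_left k two_pos]

/-! ### Closing up -/

/-- This closure turns the pairing `!mid` into one circle and `mid` into two. -/
theorem jones_attachAll_nil (hD : StatesPaired D) :
    jones (attachAll mid [] D) = normCoeff (!mid) D + loopValue * normCoeff mid D := by
  have key : bracket (attachAll mid [] D) = coeff (!mid) D + loopValue * coeff mid D := by
    rw [← one_mul (coeff (!mid) D), add_comm]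
    cases mid
    · rw [← sum_states_linear hD (w := fun S => loopValue ^ (((S.cap 0).cap 0).loops - 1))
        loopValue 1 false fun S hS => by rw [hS.closeOuter]; simp; ring]
      simp only [bracket, attachAll, states, List.map_map, Function.comp_def]
      rfl
    · rw [← sum_states_linear hD (w := fun S => loopValue ^ (((S.cap 1).cap 0).loops - 1))
        loopValue 1 true fun S hS => by rw [hS.closeInner]; simp; ring]
      simp only [bracket, attachAll, states, List.map_map, Function.comp_def]
      rfl
  have hw : writhe (attachAll mid [] D) = writhe D := by cases mid <;> rfl
  rw [jones, key, hw, normCoeff, normCoeff, framing]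
  ring

/-- A braid disappears if the two strands on which it lies are joined at its end. -/
theorem jones_attachAll_nil_attachBraid (hD : StatesPaired D) (hb : Even b) :
    jones (attachAll mid [] (attachBraid mid b D)) = jones (attachAll mid [] D) := by
  rw [jones_attachAll_nil mid (hD.attachBraid mid b), jones_attachAll_nil mid hD,
    normCoeff_not_attachBraid mid hD hb, normCoeff_attachBraid mid hD hb]
  obtain ⟨k, hk⟩ := Int.natAbs_even.2 hb
  have h := tHalf_mul_qAnalogue_mul_loopValue (braidSign_eq mid b) k
  rw [Int.abs_eq_natAbs, hk, ← two_mul,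
    show (2 * ((2 * k : ℕ) : ℤ) * braidSign mid b) = 4 * k * braidSign mid b by push_cast; ring]
  linear_combination -normCoeff (!mid) D * h

theorem jones_attachAll_nil_not_attachBraid (hD : StatesPaired D) (hb : Even b) :
    jones (attachAll (!mid) [] (attachBraid mid b D)) =
      tHalf (2 * |b| * braidSign mid b) * jones (attachAll (!mid) [] D) -
        tHalf (braidSign mid b) * qAnalogue b.natAbs (-tHalf (2 * braidSign mid b)) *
          jones (attachAll mid [] D) := by
  rw [jones_attachAll_nil (!mid) (hD.attachBraid mid b), jones_attachAll_nil mid hD,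
    jones_attachAll_nil (!mid) hD, Bool.not_not,
    normCoeff_not_attachBraid mid hD hb, normCoeff_attachBraid mid hD hb]
  obtain ⟨k, hk⟩ := Int.natAbs_even.2 hb
  have h := tHalf_mul_qAnalogue_mul_loopValue (braidSign_eq mid b) k
  rw [Int.abs_eq_natAbs, hk, ← two_mul,
    show (2 * ((2 * k : ℕ) : ℤ) * braidSign mid b) = 4 * k * braidSign mid b by push_cast; ring]
  -- The multiples of `u` agree on both sides; those of `v` agree by the geometric sum `h`.
  linear_combination normCoeff mid D * h

end Braid

/-! ### The diagrams `C[b₁, …, bₘ]` -/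

/-- The diagram `C[b₁, …, bₘ]` before it is closed up on the right. -/
def openTwoBridge (b : List ℤ) : OrientedTangle dirs :=
  (b.foldl (fun p x => (!p.1, attachBraid p.1 x p.2)) (true, leftEnd)).2

theorem foldl_attachBraid_fst (b : List ℤ) (odd : Bool) (D : OrientedTangle dirs) :
    (b.foldl (fun p x => (!p.1, attachBraid p.1 x p.2)) (odd, D)).1 =
      (odd ^^ decide (b.length % 2 = 1)) := by
  induction b generalizing odd D with
  | nil => simp
  | cons x b ih =>
    rw [List.foldl_cons, ih, List.length_cons]
    rcases Nat.mod_two_eq_zero_or_one b.length with h | h <;> simp [h, Nat.add_mod]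

/-- `attachAll` recurses from the first entry, whereas the recursion removes the last; a left fold
makes the last braid accessible. -/
theorem attachAll_eq_foldl (b : List ℤ) (odd : Bool) (D : OrientedTangle dirs) :
    attachAll odd b D = attachAll
      (b.foldl (fun p x => (!p.1, attachBraid p.1 x p.2)) (odd, D)).1 []
      (b.foldl (fun p x => (!p.1, attachBraid p.1 x p.2)) (odd, D)).2 := by
  induction b generalizing odd D with
  | nil => rfl
  | cons x b ih => rw [attachAll, ih, List.foldl_cons]

/-- Whether the braid of the entry after the entries `b` lies on the middle strands. -/
def nextMid (b : List ℤ) : Bool := decide (b.length % 2 = 0)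

theorem nextMid_concat (b : List ℤ) (x : ℤ) : nextMid (b ++ [x]) = !nextMid b := by
  rcases Nat.mod_two_eq_zero_or_one b.length with h | h <;> simp [nextMid, h, Nat.add_mod]

theorem foldl_attachBraid_fst_true (b : List ℤ) :
    (b.foldl (fun p x => (!p.1, attachBraid p.1 x p.2)) (true, leftEnd)).1 = nextMid b := by
  rw [foldl_attachBraid_fst, nextMid]
  rcases Nat.mod_two_eq_zero_or_one b.length with h | h <;> simp [h]

theorem twoBridge_eq (b : List ℤ) : twoBridge b = attachAll (nextMid b) [] (openTwoBridge b) := by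
  rw [twoBridge, attachAll_eq_foldl, foldl_attachBraid_fst_true, openTwoBridge]

theorem openTwoBridge_concat (b : List ℤ) (x : ℤ) :
    openTwoBridge (b ++ [x]) = attachBraid (nextMid b) x (openTwoBridge b) := by
  rw [openTwoBridge, List.foldl_concat, foldl_attachBraid_fst_true, openTwoBridge]

theorem statesPaired_leftEnd : StatesPaired leftEnd := by
  intro s hs
  simp only [leftEnd, states, List.map_cons, List.map_nil, List.mem_singleton] at hs
  subst hs
  exact ⟨0, 1, by simp [Arcs.cup]⟩

theorem statesPaired_openTwoBridge (b : List ℤ) : StatesPaired (openTwoBridge b) := by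
  induction b using List.reverseRecOn with
  | nil => exact statesPaired_leftEnd
  | append_singleton b x ih => rw [openTwoBridge_concat]; exact ih.attachBraid _ x

/-! ### Initial values and the recursion for the links -/

theorem jones_twoCircles : jones twoCircles = -tHalf (-1) - tHalf 1 := by
  simp [jones, twoCircles, bracket, states, writhe, Arcs.cup, Arcs.cap, tHalf]

theorem jones_twoBridge_nil : jones (twoBridge []) = 1 := by
  simp [jones, twoBridge, attachAll, leftEnd, bracket, states, writhe, Arcs.cup, Arcs.cap]

theorem jones_attachAll_false_leftEnd : jones (attachAll false [] leftEnd) = jones twoCircles := by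
  simp [jones, twoCircles, attachAll, leftEnd, bracket, states, writhe, Arcs.cup, Arcs.cap]

theorem jonesTrunc_neg_one (b : List ℤ) : jonesTrunc b (-1) = jones twoCircles := rfl

theorem jonesTrunc_natCast (b : List ℤ) (k : ℕ) :
    jonesTrunc b k = jones (twoBridge (b.take k)) := rfl

/-- Closing up `C[b₁, …, bₘ₋₁]` in the other way yields the link `C[b₁, …, bₘ₋₂]`. -/
theorem jones_attachAll_not_openTwoBridge {c : List ℤ} (hc : ∀ x ∈ c, Even x) (x : ℤ) :
    jones (attachAll (!nextMid c) [] (openTwoBridge c)) =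
      jonesTrunc (c ++ [x]) (((c ++ [x]).length : ℤ) - 2) := by
  induction c using List.reverseRecOn with
  -- Here the index is `1 - 2 = -1`, the conventional value for two circles.
  | nil => exact jones_attachAll_false_leftEnd
  | append_singleton c y _ =>
    rw [openTwoBridge_concat, nextMid_concat, Bool.not_not, jones_attachAll_nil_attachBraid _
      (statesPaired_openTwoBridge c) (hc y (by simp)), ← twoBridge_eq,
      show (((c ++ [y] ++ [x]).length : ℤ) - 2) = (c.length : ℕ) by simp,
      jonesTrunc_natCast]
    simp

theorem jones_twoBridge_concat {c : List ℤ} {x : ℤ} (hc : ∀ y ∈ c, Even y) (hx : Even x) :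
    jones (twoBridge (c ++ [x])) =
      tHalf (2 * |x| * braidSign (nextMid c) x) *
          jonesTrunc (c ++ [x]) (((c ++ [x]).length : ℤ) - 2) -
        tHalf (braidSign (nextMid c) x) * qAnalogue x.natAbs (-tHalf (2 * braidSign (nextMid c) x)) *
          jonesTrunc (c ++ [x]) (((c ++ [x]).length : ℤ) - 1) := by
  have h1 : jonesTrunc (c ++ [x]) (((c ++ [x]).length : ℤ) - 1) = jones (twoBridge c) := by
    rw [show (((c ++ [x]).length : ℤ) - 1) = (c.length : ℕ) by simp, jonesTrunc_natCast]
    simp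
  rw [← jones_attachAll_not_openTwoBridge hc, h1, twoBridge_eq, nextMid_concat,
    openTwoBridge_concat, jones_attachAll_nil_not_attachBraid _ (statesPaired_openTwoBridge c) hx,
    twoBridge_eq c]

/-- The type of the continued fraction is the crossing sign of its last braid. A zero entry would
have sign `0`, which is no crossing sign. -/
theorem getLast?_typeSeq_concat {c : List ℤ} {x : ℤ} (hx : x ≠ 0) :
    (typeSeq (c ++ [x])).getLast? = some (braidSign (nextMid c) x) := by
  have h : (typeSeq (c ++ [x])).getLast? = some ((-1) ^ c.length * x.sign) := by
    simp [typeSeq, List.mapIdx_append]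
  rw [h, braidSign, nextMid]
  rcases Nat.mod_two_eq_zero_or_one c.length with hl | hl <;>
    rcases lt_or_gt_of_ne hx with h0 | h0
  all_goals
    first
    | rw [(Nat.even_iff.2 hl).neg_one_pow]
    | rw [(Nat.odd_iff.2 hl).neg_one_pow]
    first
    | rw [Int.sign_eq_neg_one_of_neg h0]
    | rw [Int.sign_eq_one_of_pos h0]
    simp [hl, h0, h0.not_gt, shapeSign]

theorem jones_twoBridge_singleton {x : ℤ} (hx : Even x) :
    jones (twoBridge [x]) =
      tHalf (2 * |x| * braidSign true x) * (-tHalf (-1) - tHalf 1) -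
        tHalf (braidSign true x) * qAnalogue x.natAbs (-tHalf (2 * braidSign true x)) := by
  have h := jones_twoBridge_concat (c := []) (by simp) hx
  rw [List.nil_append, show (([x].length : ℤ) - 2) = -1 from rfl, jonesTrunc_neg_one,
    show (([x].length : ℤ) - 1) = (0 : ℕ) from rfl, jonesTrunc_natCast, List.take_zero,
    jones_twoBridge_nil, mul_one, jones_twoCircles] at h
  exact h

end TwoBridge

/-! ### The theorem: splitting by the sign of the last braid -/

open TwoBridge in
theorem theorem5p3 :
    (∀ (b : List ℤ) (_ : IsEvenCF b) (hm : b ≠ []),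
      ((typeSeq b).getLast? = some (-1) →
        jones (twoBridge b) =
          tHalf (-2 * |b.getLast hm|) * jonesTrunc b ((b.length : ℤ) - 2)
            - tHalf (-1) * qAnalogue (b.getLast hm).natAbs (-tHalf (-2))
              * jonesTrunc b ((b.length : ℤ) - 1)) ∧
      ((typeSeq b).getLast? = some 1 →
        jones (twoBridge b) =
          tHalf (2 * |b.getLast hm|) * jonesTrunc b ((b.length : ℤ) - 2)
            - tHalf 1 * qAnalogue (b.getLast hm).natAbs (-tHalf 2)
              * jonesTrunc b ((b.length : ℤ) - 1))) ∧
    (∀ b : List ℤ, jonesTrunc b 0 = 1 ∧ jonesTrunc b (-1) = -tHalf (-1) - tHalf 1) ∧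
    (∀ b₁ : ℤ, Even b₁ →
      (b₁ < 0 → jones (twoBridge [b₁]) =
        tHalf (2 * b₁) * (-tHalf (-1) - tHalf 1)
          - tHalf (-1) * qAnalogue b₁.natAbs (-tHalf (-2))) ∧
      (0 < b₁ → jones (twoBridge [b₁]) =
        tHalf (2 * b₁) * (-tHalf (-1) - tHalf 1)
          - tHalf 1 * qAnalogue b₁.natAbs (-tHalf 2))) := by

  refine ⟨fun b hb hm => ?_, fun b => ⟨jones_twoBridge_nil, jones_twoCircles⟩, fun x hx => ?_⟩
  · obtain ⟨c, x, rfl⟩ : ∃ c x, b = c ++ [x] :=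
      ⟨b.dropLast, b.getLast hm, (List.dropLast_append_getLast hm).symm⟩
    have hx := hb x (by simp)
    have key := jones_twoBridge_concat (c := c) (fun y hy => (hb y (by simp [hy])).1) hx.1
    rw [getLast?_typeSeq_concat hx.2, List.getLast_append_singleton]
    refine ⟨fun h => ?_, fun h => ?_⟩ <;> rw [Option.some_inj] at h <;> rw [h] at key <;>
      rw [key]
    · rw [show 2 * |x| * -1 = -2 * |x| by ring, show (2 * -1 : ℤ) = -2 by norm_num]
    · rw [mul_one, mul_one]
  -- For a single entry the crossing sign is that of `b₁`, so `|b₁|` times this sign is `b₁` in both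
  -- cases.
  · have key := jones_twoBridge_singleton hx
    refine ⟨fun h => ?_, fun h => ?_⟩ <;> rw [key]
    · have hs : braidSign true x = -1 := by simp [braidSign, shapeSign, h]
      rw [hs, abs_of_neg h, show 2 * -x * -1 = 2 * x by ring, show (2 * -1 : ℤ) = -2 by norm_num]
    · have hs : braidSign true x = 1 := by simp [braidSign, shapeSign, h.not_gt]
      rw [hs, abs_of_pos h, mul_one, mul_one]
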